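/- Theorem 5.1. Let $n,t\ge 0$ be integers, let $x,x_0,x_1,\dots,x_n$ be pairwise distinct numbers in the interval $[p,q]$, and let $f\in C^{n+t+1}[p,q]$ be real-valued (derivatives at the end points are one-sided). Put $$L_i(x)=\prod_{\substack{j=0\\ j\ne i}}^n\frac{x-x_j}{x_i-x_j}\quad(0\le i\le n),\qquad \rho_k=\sum_{i=0}^n\frac{L_i(x)}{(x_i-x)^k}\quad(1\le k\le t),$$ $$a_0=1,\qquad a_k=-(\rho_k a_0+\rho_{k-1}a_1+\dots+\rho_1 a_{k-1})\quad(1\le k\le t).$$ Let $f[z_0,\dots,z_m]$ denote the divided difference of $f$ with possibly repeated arguments: $f[z,\dots,z]=f^{(m)}(z)/m!$ for $m+1$ equal arguments, and $f[z_0,\dots,z_m]=\dfrac{f[z_0,\dots,\widehat{z_k},\dots,z_m]-f[z_0,\dots,\widehat{z_l},\dots,z_m]}{z_l-z_k}$ whenever $z_k\neq z_l$, where the hat marks an omitted argument. Empty sums are $0$. Then (i) $$\frac{f^{(t)}(x)}{t!}=\sum_{i=0}^n\left(\sum_{s=0}^{t-1}\frac{a_s}{(x_i-x)^{t-s}}\right)f(x_i)L_i(x)+a_t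 f(x)+\prod_{i=0}^n(x-x_i)\;\sum_{s=0}^{t-1}a_s\, f[\underbrace{x,\dots,x}_{t-s+1\text{ times}},x_0,\dots,x_n].$$ Moreover, there are $\xi_0,\dots,\xi_t$ in the smallest closed interval containing $x,x_0,\dots,x_n$ such that both (ii) $$\frac{f^{(t)}(x)}{t!}=\sum_{i=0}^n\left(\sum_{s=0}^{t-1}\frac{a_s}{(x_i-x)^{t-s}}\right)f(x_i)L_i(x)+a_t f(x)+\prod_{i=0}^n(x-x_i)\;\sum_{s=0}^{t-1}a_s\,\frac{f^{(t+n+1-s)}(\xi_s)}{(t+n+1-s)!}$$ and (iii) $$\frac{f^{(t)}(x)}{t!}=\sum_{i=0}^n\left(\sum_{s=0}^{t}\frac{a_s}{(x_i-x)^{t-s}}\right)f(x_i)L_i(x)+\prod_{i=0}^n(x-x_i)\;\sum_{s=0}^{t}a_s\,\frac{f^{(t+n+1-s)}(\xi_s)}{(t+n+1-s)!}.$$ -/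

import Mathlib

namespace NumDiff

/-- The divided difference `f[z₀, z₁, …, z_k]` of a function `f` on `S` at a list of points that may
be repeated, by the usual recursion: `f[z, …, z] = f^(k)(z) / k!` if all `k + 1` points coincide
with `z`, and otherwise
`f[z₀, …, z_k] = (f[all points but one copy of a] - f[all points but one copy of b]) / (b - a)`,
where `a` is the first point of the list and `b` is the first point that differs from `a`.
Derivatives are taken within `S` (so they are one-sided at the end points of an interval). -/
noncomputable def divDiff (f : ℝ → ℝ) (S : Set ℝ) : List ℝ → ℝ
  | [] => 0
  | a :: l =>
    match _h : l.find? (fun b => decide (b ≠ a)) with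
    | none => iteratedDerivWithin l.length f S a / (Nat.factorial l.length : ℝ)
    | some b => (divDiff f S l - divDiff f S (a :: l.erase b)) / (b - a)
termination_by l => l.length
decreasing_by
  · simp
  · have hb : b ∈ l := List.mem_of_find?_eq_some _h
    have hl : 0 < l.length := List.length_pos_of_mem hb
    simp only [List.length_cons, List.length_erase_of_mem hb]
    omega

/-- `L_i(x) = ∏_{j ≠ i} (x - x_j) / (x_i - x_j)`. -/
noncomputable def lagr {n : ℕ} (xs : Fin (n + 1) → ℝ) (x : ℝ) (i : Fin (n + 1)) : ℝ :=
  ∏ j ∈ Finset.univ.erase i, (x - xs j) / (xs i - xs j)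

/-- `ρ_k = ∑_i L_i(x) / (x_i - x)^k`. -/
noncomputable def rho {n : ℕ} (xs : Fin (n + 1) → ℝ) (x : ℝ) (k : ℕ) : ℝ :=
  ∑ i, lagr xs x i / (xs i - x) ^ k

/-- `a_0 = 1` and `a_k = -(ρ_k a_0 + ρ_{k-1} a_1 + ⋯ + ρ_1 a_{k-1})` for `k ≥ 1`. -/
noncomputable def coeffA {n : ℕ} (xs : Fin (n + 1) → ℝ) (x : ℝ) : ℕ → ℝ
  | 0 => 1
  | k + 1 => -∑ s : Fin (k + 1), rho xs x (k + 1 - s) * coeffA xs x s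
termination_by k => k
decreasing_by exact s.isLt

end NumDiff

/-! Write `g_k = f^(k)(x)/k!`, and let `r_m(y)` be `f(y)` minus its Taylor polynomial at `x` of
degree below `m`, divided by `(y - x)^m`. The divided difference with `m` copies of `x` is the
ordinary divided difference of `r_m` at the `x_i`, that is `∑ r_m(x_i) w_i` with the nodal weights
`w_i` (`divDiff_replicate_append_map`).

Since `∏ (x - x_j) * w_i = (x - x_i) L_i`, multiplying the difference with `m + 1` copies by the
product gives `∑_{k ≤ m} g_k ρ_{m-k} - ∑ f(x_i) L_i / (x_i - x)^m`, where `ρ_0 = 1`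
(`prod_mul_divDiff`). Take `m = t - s`, weight by `a_s` and sum: the power series of `a` and `ρ` are
inverse to each other, so the convolution of `a`, `ρ` and `g` collapses to `g_t`. The case `m = 0`
is Lagrange's formula with remainder and exchanges the term `s = t` for `a_t f(x)`.

For the mean value forms, the divided difference is the leading coefficient of a Hermite interpolant
of `f`; Rolle's theorem with a multiple zero at `x` turns it into a derivative. -/

namespace NumDiff

/-! ### Rolle's theorem with one multiple zero -/

open Finset

/-- If `F` vanishes at `r + 1` points of an order connected set, its derivative vanishes at `r`
other points of that set. -/
theorem exists_finset_deriv_eq_zero {K : Set ℝ} (hK : K.OrdConnected) {F F' : ℝ → ℝ}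
    (hF : ∀ z ∈ K, HasDerivWithinAt F (F' z) K z) {r : ℕ} {A : Finset ℝ} (hA : (A : Set ℝ) ⊆ K)
    (hcard : A.card = r + 1) (hzero : ∀ z ∈ A, F z = 0) :
    ∃ B : Finset ℝ, (B : Set ℝ) ⊆ K ∧ B.card = r ∧ (∀ z ∈ B, F' z = 0) ∧ Disjoint A B := by
  classical
  set y := A.orderEmbOfFin hcard with hy
  have hmem : ∀ i, y i ∈ A := fun i => A.orderEmbOfFin_mem hcard i
  have hex : ∀ i : Fin r, ∃ z ∈ Set.Ioo (y i.castSucc) (y i.succ), F' z = 0 := by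
    intro i
    have hlt : y i.castSucc < y i.succ := y.strictMono Fin.castSucc_lt_succ
    have hsub : Set.Icc (y i.castSucc) (y i.succ) ⊆ K := hK.out (hA (hmem _)) (hA (hmem _))
    refine exists_hasDerivAt_eq_zero hlt
      (fun z hz => ((hF z (hsub hz)).continuousWithinAt).mono hsub) ?_ ?_
    · rw [hzero _ (hmem _), hzero _ (hmem _)]
    · intro z hz
      exact (hF z (hsub (Set.Ioo_subset_Icc_self hz))).hasDerivAt
        (Filter.mem_of_superset (Icc_mem_nhds hz.1 hz.2) hsub)
  choose c hc hc0 using hex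
  have hmono : StrictMono c := by
    intro i j hij
    calc c i < y i.succ := (hc i).2
      _ ≤ y j.castSucc := y.monotone (by rw [Fin.le_def]; simpa using hij)
      _ < c j := (hc j).1
  refine ⟨univ.image c, ?_, ?_, ?_, ?_⟩
  · intro z hz
    obtain ⟨i, -, rfl⟩ := mem_image.1 (mem_coe.1 hz)
    exact hK.out (hA (hmem _)) (hA (hmem _)) (Set.Ioo_subset_Icc_self (hc i))
  · rw [card_image_of_injective _ hmono.injective, card_univ, Fintype.card_fin]
  · intro z hz
    obtain ⟨i, -, rfl⟩ := mem_image.1 hz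
    exact hc0 i
  · rw [disjoint_left]
    intro z hzA hzB
    obtain ⟨i, -, rfl⟩ := mem_image.1 hzB
    -- A zero found strictly between consecutive points of `A` cannot itself belong to `A`.
    have : c i ∈ Set.range y := by rw [hy, A.range_orderEmbOfFin hcard]; exact hzA
    obtain ⟨j, hj⟩ := this
    have h1 := (hc i).1
    have h2 := (hc i).2
    rw [← hj, y.lt_iff_lt, Fin.lt_def] at h1 h2
    simp at h1 h2
    omega

/-- Rolle's theorem for a function, given with its successive derivatives, that has `r + 1` simple
zeros and no multiple ones. -/
theorem exists_iterated_deriv_eq_zero {K : Set ℝ} (hK : K.OrdConnected) (r : ℕ) :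
    ∀ (F : ℕ → ℝ → ℝ) (A : Finset ℝ),
      (∀ k < r, ∀ z ∈ K, HasDerivWithinAt (F k) (F (k + 1) z) K z) → (A : Set ℝ) ⊆ K →
      A.card = r + 1 → (∀ z ∈ A, F 0 z = 0) → ∃ ξ ∈ K, F r ξ = 0 := by
  induction r with
  | zero =>
    intro F A _ hA hcard hzero
    obtain ⟨z, hz⟩ := card_pos.1 (by omega : 0 < A.card)
    exact ⟨z, hA hz, hzero z hz⟩
  | succ r ih =>
    intro F A hF hA hcard hzero
    obtain ⟨B, hB, hBcard, hBzero, -⟩ :=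
      exists_finset_deriv_eq_zero hK (hF 0 (by omega)) hA hcard hzero
    exact ih (fun k => F (k + 1)) B (fun k hk => hF (k + 1) (by omega)) hB hBcard hBzero

/-- Rolle's theorem for a function, given with its successive derivatives, that has `r + 1` simple
zeros and a zero of multiplicity `m` at another point `x`. -/
theorem exists_iterated_deriv_eq_zero_of_multiple {K : Set ℝ} (hK : K.OrdConnected) {x : ℝ}
    (hx : x ∈ K) (r m : ℕ) :
    ∀ (F : ℕ → ℝ → ℝ) (A : Finset ℝ),
      (∀ k < r + m, ∀ z ∈ K, HasDerivWithinAt (F k) (F (k + 1) z) K z) → (A : Set ℝ) ⊆ K →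
      A.card = r + 1 → x ∉ A → (∀ z ∈ A, F 0 z = 0) → (∀ k < m, F k x = 0) →
      ∃ ξ ∈ K, F (r + m) ξ = 0 := by
  classical
  induction m with
  | zero =>
    intro F A hF hA hcard _ hzero _
    exact exists_iterated_deriv_eq_zero hK r F A hF hA hcard hzero
  | succ m ih =>
    intro F A hF hA hcard hxA hzero hzx
    -- Counting `x` as one more zero keeps the number of simple zeros at `r + 1` after
    -- differentiation. As `B` avoids `x`, the remaining multiplicity `m` at `x` is not counted
    -- twice.
    obtain ⟨B, hB, hBcard, hBzero, hdisj⟩ :=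
      exists_finset_deriv_eq_zero hK (hF 0 (by omega)) (A := insert x A) (r := r + 1)
        (by rw [coe_insert]; exact Set.insert_subset hx hA)
        (by rw [card_insert_of_notMem hxA, hcard])
        (by
          intro z hz
          rcases mem_insert.1 hz with rfl | hz
          · exact hzx 0 (by omega)
          · exact hzero z hz)
    exact ih (fun k => F (k + 1)) B (fun k hk => hF (k + 1) (by omega)) hB hBcard
      (fun h => disjoint_left.1 hdisj (mem_insert_self x A) h) hBzero
      (fun k hk => hzx (k + 1) (by omega))

end NumDiff
-- Explicit form of divided differences with one repeated argument
namespace NumDiff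

open Finset Polynomial

section Lagrange

variable {ι : Type*} [DecidableEq ι] {v : ι → ℝ} {s : Finset ι}

/-- Adding the node `v i` divides the weight of `k` by `v k - v i`, which the extra factor cancels.
-/
theorem sum_nodalWeight_insert_mul_sub (hv : Function.Injective v) {i : ι} (hi : i ∉ s)
    (r : ι → ℝ) :
    ∑ k ∈ insert i s, (v k - v i) * r k * Lagrange.nodalWeight (insert i s) v k
      = ∑ k ∈ s, r k * Lagrange.nodalWeight s v k := by
  rw [sum_insert hi, sub_self, zero_mul, zero_mul, zero_add]
  refine sum_congr rfl fun k hk => ?_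
  have hki : k ≠ i := fun h => hi (h ▸ hk)
  have hsub : v k - v i ≠ 0 := sub_ne_zero.2 (hv.ne hki)
  rw [Lagrange.nodalWeight, Lagrange.nodalWeight, erase_insert_of_ne hki.symm,
    prod_insert (fun h => hi (mem_of_mem_erase h))]
  field_simp

/-- The sum is the top coefficient of the interpolant of the constant `1`. -/
theorem sum_nodalWeight_eq_zero (hv : Function.Injective v) (hs : 2 ≤ s.card) :
    ∑ k ∈ s, Lagrange.nodalWeight s v k = 0 := by
  have h := Lagrange.coeff_eq_sum (s := s) (v := v) hv.injOn (P := (1 : ℝ[X]))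
    (by rw [degree_one]; exact_mod_cast (by omega : 0 < s.card))
  rw [coeff_one, if_neg (by omega)] at h
  rw [h]
  simp [Lagrange.nodalWeight, prod_inv_distrib]

/-- The explicit form of the recursion of ordinary divided differences. -/
theorem sum_nodalWeight_insert_sub_sum (hv : Function.Injective v) {i j : ι} (hij : i ≠ j)
    (hi : i ∉ s) (hj : j ∉ s) (r : ι → ℝ) :
    (∑ k ∈ insert j s, r k * Lagrange.nodalWeight (insert j s) v k
      - ∑ k ∈ insert i s, r k * Lagrange.nodalWeight (insert i s) v k) / (v j - v i)
      = ∑ k ∈ insert i (insert j s), r k * Lagrange.nodalWeight (insert i (insert j s)) v k := by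
  rw [div_eq_iff (sub_ne_zero.2 (hv.ne hij.symm)),
    ← sum_nodalWeight_insert_mul_sub hv (i := i) (s := insert j s) (by simp [hij, hi]) r,
    ← sum_nodalWeight_insert_mul_sub hv (i := j) (s := insert i s) (by simp [hij.symm, hj]) r,
    Finset.insert_comm j i s, ← sum_sub_distrib, sum_mul]
  exact sum_congr rfl fun k _ => by ring

end Lagrange

/-- The quotient of `f y - ∑_{k < m} g_k (y - x) ^ k` by `(y - x) ^ m`. -/
noncomputable def taylorQuotient (f : ℝ → ℝ) (g : ℕ → ℝ) (x : ℝ) (m : ℕ) (y : ℝ) : ℝ :=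
  (f y - ∑ k ∈ range m, g k * (y - x) ^ k) / (y - x) ^ m

theorem taylorQuotient_zero (f : ℝ → ℝ) (g : ℕ → ℝ) (x y : ℝ) :
    taylorQuotient f g x 0 y = f y := by
  simp [taylorQuotient]

theorem taylorQuotient_eq (f : ℝ → ℝ) (g : ℕ → ℝ) {x y : ℝ} (hy : y ≠ x) (m : ℕ) :
    taylorQuotient f g x m y = (y - x) * taylorQuotient f g x (m + 1) y + g m := by
  have : y - x ≠ 0 := sub_ne_zero.2 hy
  rw [taylorQuotient, taylorQuotient, sum_range_succ]
  field_simp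
  ring

theorem divDiff_replicate (f : ℝ → ℝ) (S : Set ℝ) (x : ℝ) (m : ℕ) :
    divDiff f S (List.replicate (m + 1) x)
      = iteratedDerivWithin m f S x / (Nat.factorial m : ℝ) := by
  have hfind : (List.replicate m x).find? (fun b => decide (b ≠ x)) = none := by
    simp
  rw [List.replicate_succ, divDiff]
  split
  · simp
  · simp_all

theorem divDiff_replicate_append_cons (f : ℝ → ℝ) (S : Set ℝ) {x y : ℝ} (hy : y ≠ x) (m : ℕ)
    (l : List ℝ) :
    divDiff f S (List.replicate (m + 1) x ++ y :: l)
      = (divDiff f S (List.replicate m x ++ y :: l)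
          - divDiff f S (List.replicate (m + 1) x ++ l)) / (y - x) := by
  have hfind : (List.replicate m x ++ y :: l).find? (fun b => decide (b ≠ x)) = some y := by
    simp [hy]
  have herase : (List.replicate m x ++ y :: l).erase y = List.replicate m x ++ l := by
    rw [List.erase_append_right _ (by simp [List.mem_replicate, hy]), List.erase_cons_head]
  rw [List.replicate_succ, List.cons_append, divDiff]
  split
  · simp_all
  · rename_i b hb
    obtain rfl : y = b := by
      rw [hfind] at hb
      exact Option.some.inj hb
    rw [herase, List.cons_append]

section ExplicitForm

variable {ι : Type*} [DecidableEq ι] {v : ι → ℝ}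

theorem divDiff_map_of_nodup (f : ℝ → ℝ) (S : Set ℝ) (hv : Function.Injective v) (N : ℕ) :
    ∀ l : List ι, l.length = N + 1 → l.Nodup →
      divDiff f S (l.map v)
        = ∑ i ∈ l.toFinset, f (v i) * Lagrange.nodalWeight l.toFinset v i := by
  induction N with
  | zero =>
    intro l hl _
    obtain ⟨i, rfl⟩ := List.length_eq_one_iff.1 hl
    have h := divDiff_replicate f S (v i) 0
    simpa [Lagrange.nodalWeight] using h
  | succ N ih =>
    intro l hl hnd
    match l, hl, hnd with
    | i :: j :: l, hl, hnd =>
      simp only [List.nodup_cons, List.mem_cons, not_or] at hnd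
      obtain ⟨⟨hij, hi⟩, hj, hnd⟩ := hnd
      simp only [List.length_cons] at hl
      have h := divDiff_replicate_append_cons f S (hv.ne hij).symm 0 (l.map v)
      simp only [zero_add, List.replicate_one, List.replicate_zero, List.nil_append,
        List.cons_append] at h
      have h1 := ih (j :: l) (by simp; omega) (by simp [hj, hnd])
      have h2 := ih (i :: l) (by simp; omega) (by simp [hi, hnd])
      simp only [List.map_cons, List.toFinset_cons] at h1 h2 ⊢
      rw [h, h1, h2]
      exact sum_nodalWeight_insert_sub_sum hv hij (by simpa using hi) (by simpa using hj) _

/-- The divided difference with one repeated argument `x` is the ordinary divided difference of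
the Taylor quotient of `f` at `x`. -/
theorem divDiff_replicate_append_map (f : ℝ → ℝ) (S : Set ℝ) (hv : Function.Injective v) {x : ℝ}
    (hne : ∀ i, v i ≠ x) (m : ℕ) :
    ∀ l : List ι, l ≠ [] → l.Nodup →
      divDiff f S (List.replicate m x ++ l.map v)
        = ∑ i ∈ l.toFinset,
            taylorQuotient f (fun k => iteratedDerivWithin k f S x / (Nat.factorial k : ℝ)) x m (v i)
              * Lagrange.nodalWeight l.toFinset v i := by
  induction m with
  | zero =>
    intro l hl hnd
    simp only [taylorQuotient_zero, List.replicate_zero, List.nil_append]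
    exact divDiff_map_of_nodup f S hv (l.length - 1) l
      (by have := List.length_pos_iff.2 hl; omega) hnd
  | succ m ihm =>
    set g : ℕ → ℝ := fun k => iteratedDerivWithin k f S x / (Nat.factorial k : ℝ) with hg
    intro l
    induction l with
    | nil => intro h; exact absurd rfl h
    | cons i l ihl =>
      intro _ hnd
      rw [List.map_cons, divDiff_replicate_append_cons f S (hne i), ← List.map_cons,
        ihm (i :: l) (by simp) hnd, div_eq_iff (sub_ne_zero.2 (hne i))]
      rw [List.nodup_cons] at hnd
      rcases eq_or_ne l [] with rfl | hl
      · have h := divDiff_replicate f S x m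
        simp only [List.map_nil, List.append_nil, h, List.toFinset_cons, List.toFinset_nil,
          insert_empty_eq, sum_singleton, taylorQuotient_eq f g (hne i) m]
        simp [Lagrange.nodalWeight, hg]
        ring
      · have hi : i ∉ l.toFinset := by simpa using hnd.1
        have hcard : 2 ≤ (insert i l.toFinset).card := by
          rw [card_insert_of_notMem hi]
          have : 0 < l.toFinset.card := card_pos.2 (List.toFinset_nonempty_iff _ |>.2 hl)
          omega
        rw [ihl hl hnd.2, List.toFinset_cons, ← sum_nodalWeight_insert_mul_sub hv hi, sub_eq_iff_eq_add,
          sum_mul, ← sum_add_distrib]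
        have h0 := sum_nodalWeight_eq_zero hv hcard
        have : ∑ k ∈ insert i l.toFinset, g m * Lagrange.nodalWeight (insert i l.toFinset) v k = 0 := by
          rw [← mul_sum, h0, mul_zero]
        -- The factors `v k - v i` and `v i - x` add up to `v k - x`; the vanishing sum supplies the
        -- `g m` needed to match `taylorQuotient_eq` term by term.
        rw [← add_zero (∑ k ∈ _, (_ + _)), ← this, ← sum_add_distrib]
        refine sum_congr rfl fun k _ => ?_
        rw [taylorQuotient_eq f g (hne k) m]
        ring

end ExplicitForm

end NumDiff
-- Hermite interpolation and the mean value theorem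
namespace NumDiff

open Finset Polynomial

theorem eval_iterate_derivative_of_natDegree_le {U : ℝ[X]} {N : ℕ} (hU : U.natDegree ≤ N) (z : ℝ) :
    (derivative^[N] U).eval z = (N.factorial : ℝ) * U.coeff N := by
  have h : (derivative^[N] U).natDegree ≤ 0 :=
    (natDegree_iterate_derivative U N).trans (by omega)
  rw [eq_C_of_natDegree_le_zero h, eval_C, coeff_iterate_derivative]
  simp [Nat.descFactorial_self]

/-- Hermite interpolation: prescribed Taylor coefficients `g_k`, `k < m`, at `0`, and prescribed
values at further nodes. -/
theorem exists_hermite_interpolant {n : ℕ} {xs : Fin (n + 1) → ℝ} {x : ℝ} (f : ℝ → ℝ)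
    (g : ℕ → ℝ) (hinj : Function.Injective xs) (hne : ∀ i, xs i ≠ x) (m : ℕ) :
    ∃ U : ℝ[X], U.natDegree ≤ n + m ∧ (∀ k < m, U.coeff k = g k) ∧
      (∀ i, U.eval (xs i - x) = f (xs i)) ∧
      U.coeff (n + m)
        = ∑ i, taylorQuotient f g x m (xs i) * Lagrange.nodalWeight univ xs i := by
  have hw : Set.InjOn (fun i => xs i - x) ((univ : Finset (Fin (n + 1))) : Set (Fin (n + 1))) :=
    fun i _ j _ h => hinj (sub_left_injective h)
  set Q := Lagrange.interpolate univ (fun i => xs i - x)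
    (fun i => taylorQuotient f g x m (xs i)) with hQ
  have hQdeg : Q.degree < ((univ : Finset (Fin (n + 1))).card : ℕ) :=
    Lagrange.degree_interpolate_lt _ hw
  have hQeval : ∀ i, Q.eval (xs i - x) = taylorQuotient f g x m (xs i) := fun i =>
    Lagrange.eval_interpolate_at_node _ hw (mem_univ i)
  have hQnat : Q.natDegree ≤ n := by
    rw [card_univ, Fintype.card_fin] at hQdeg
    exact natDegree_le_of_degree_le (Order.lt_succ_iff.1 (by exact_mod_cast hQdeg))
  have hQcoeff := Lagrange.coeff_eq_sum hw hQdeg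
  rw [card_univ, Fintype.card_fin, Nat.add_sub_cancel] at hQcoeff
  have hTcoeff : ∀ k, (∑ j ∈ range m, C (g j) * X ^ j : ℝ[X]).coeff k
      = if k < m then g k else 0 := by
    intro k
    simp [finsetSum_coeff, coeff_C_mul, coeff_X_pow]
  -- Taylor part plus `X ^ m` times the Lagrange interpolant of the Taylor quotients, in the
  -- variable `y - x`.
  refine ⟨∑ j ∈ range m, C (g j) * X ^ j + Q * X ^ m, ?_, ?_, ?_, ?_⟩
  · refine natDegree_add_le_of_degree_le ?_ ?_
    · refine natDegree_sum_le_of_forall_le _ _ fun j hj => ?_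
      exact (natDegree_C_mul_X_pow_le _ _).trans (by have := mem_range.1 hj; omega)
    · exact natDegree_mul_le_of_le hQnat (natDegree_X_pow_le m)
  · intro k hk
    rw [coeff_add, hTcoeff, if_pos hk, coeff_mul_X_pow', if_neg (by omega), add_zero]
  · intro i
    have : xs i - x ≠ 0 := sub_ne_zero.2 (hne i)
    rw [eval_add, eval_mul, hQeval, taylorQuotient, eval_finsetSum]
    simp only [eval_mul, eval_C, eval_pow, eval_X]
    field_simp
    ring
  · rw [coeff_add, hTcoeff, if_neg (by omega), zero_add, coeff_mul_X_pow, hQcoeff]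
    refine sum_congr rfl fun i _ => ?_
    rw [hQeval, Lagrange.nodalWeight, prod_inv_distrib, div_eq_mul_inv]
    simp only [sub_sub_sub_cancel_right]

theorem divDiff_replicate_append_ofFn {n : ℕ} {xs : Fin (n + 1) → ℝ} {x : ℝ} (f : ℝ → ℝ)
    (S : Set ℝ) (hinj : Function.Injective xs) (hne : ∀ i, xs i ≠ x) (m : ℕ) :
    divDiff f S (List.replicate m x ++ List.ofFn xs)
      = ∑ i, taylorQuotient f (fun k => iteratedDerivWithin k f S x / (Nat.factorial k : ℝ)) x m
          (xs i) * Lagrange.nodalWeight univ xs i := by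
  rw [List.ofFn_eq_map, divDiff_replicate_append_map f S hinj hne m (List.finRange (n + 1))
    (by simp [List.finRange_succ]) (List.nodup_finRange _), List.toFinset_finRange]

/-- The mean value theorem for divided differences with one repeated argument. -/
theorem exists_divDiff_eq_iteratedDerivWithin {n m : ℕ} {p q x : ℝ} {xs : Fin (n + 1) → ℝ}
    {f : ℝ → ℝ} (hx : x ∈ Set.Icc p q) (hxs : ∀ i, xs i ∈ Set.Icc p q)
    (hinj : Function.Injective xs) (hne : ∀ i, xs i ≠ x)
    (hf : ContDiffOn ℝ ((n + m : ℕ) : WithTop ℕ∞) f (Set.Icc p q)) :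
    ∃ ξ ∈ convexHull ℝ (insert x (Set.range xs)),
      divDiff f (Set.Icc p q) (List.replicate m x ++ List.ofFn xs)
        = iteratedDerivWithin (n + m) f (Set.Icc p q) ξ / (Nat.factorial (n + m) : ℝ) := by
  classical
  set S := Set.Icc p q with hS
  set K := convexHull ℝ (insert x (Set.range xs)) with hK
  -- A nondegenerate interval is needed for unique derivatives within it.
  have hpq : p < q := by
    rcases lt_or_gt_of_ne (hne 0) with h | h
    · exact (hxs 0).1.trans_lt (h.trans_le hx.2)
    · exact hx.1.trans_lt (h.trans_le (hxs 0).2)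
  have hKS : K ⊆ S := convexHull_min
    (Set.insert_subset hx (Set.range_subset_iff.2 hxs)) (convex_Icc p q)
  have hsub : insert x (Set.range xs) ⊆ K := subset_convexHull ℝ _
  set g : ℕ → ℝ := fun k => iteratedDerivWithin k f S x / (Nat.factorial k : ℝ) with hg
  obtain ⟨U, hUdeg, hUg, hUf, hUc⟩ := exists_hermite_interpolant f g hinj hne m
  obtain ⟨ξ, hξ, hzero⟩ := exists_iterated_deriv_eq_zero_of_multiple
    (convex_convexHull ℝ (insert x (Set.range xs))).ordConnected
    (hsub (Set.mem_insert _ _)) n m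
    (fun k z => iteratedDerivWithin k f S z - (derivative^[k] U).eval (z - x)) (univ.image xs)
    (by
      intro k hk z hz
      have h1 : HasDerivWithinAt (iteratedDerivWithin k f S)
          (iteratedDerivWithin (k + 1) f S z) S z := by
        rw [iteratedDerivWithin_succ]
        exact ((hf.differentiableOn_iteratedDerivWithin (by exact_mod_cast hk)
          (uniqueDiffOn_Icc hpq)) z (hKS hz)).hasDerivWithinAt
      have h2 : HasDerivAt (fun z => (derivative^[k] U).eval (z - x))
          ((derivative^[k + 1] U).eval (z - x)) z := by
        rw [Function.iterate_succ_apply']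
        exact ((derivative^[k] U).hasDerivAt (z - x)).comp_sub_const z x
      exact (h1.mono hKS).sub h2.hasDerivWithinAt)
    (by
      intro z hz
      obtain ⟨i, -, rfl⟩ := mem_image.1 (mem_coe.1 hz)
      exact hsub (Set.mem_insert_of_mem _ (Set.mem_range_self i)))
    (by rw [card_image_of_injective _ hinj, card_univ, Fintype.card_fin])
    (by simpa using hne)
    (by
      intro z hz
      obtain ⟨i, -, rfl⟩ := mem_image.1 hz
      simp [hUf i])
    (by
      intro k hk
      have : (k.factorial : ℝ) ≠ 0 := by positivity
      rw [sub_self, ← coeff_zero_eq_eval_zero, coeff_iterate_derivative, zero_add,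
        Nat.descFactorial_self, hUg k hk, nsmul_eq_mul, hg]
      field_simp
      ring)
  refine ⟨ξ, hξ, ?_⟩
  have hfac : ((n + m).factorial : ℝ) ≠ 0 := by positivity
  rw [eval_iterate_derivative_of_natDegree_le hUdeg, hUc, sub_eq_zero] at hzero
  rw [divDiff_replicate_append_ofFn f S hinj hne, hzero, mul_div_cancel_left₀ _ hfac]

/-! ### The coefficients `a_k` and the exact formulas -/

section Coefficients

variable {n : ℕ} {xs : Fin (n + 1) → ℝ} {x : ℝ}

theorem prod_sub_mul_nodalWeight (i : Fin (n + 1)) :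
    (∏ j, (x - xs j)) * Lagrange.nodalWeight univ xs i = (x - xs i) * lagr xs x i := by
  rw [← mul_prod_erase univ _ (mem_univ i), lagr, Lagrange.nodalWeight, mul_assoc,
    ← prod_mul_distrib]
  simp only [div_eq_mul_inv]

theorem rho_zero (hinj : Function.Injective xs) : rho xs x 0 = 1 := by
  have h := congrArg (eval x) (Lagrange.sum_basis (s := univ) (v := xs) hinj.injOn univ_nonempty)
  rw [eval_finsetSum, eval_one] at h
  rw [rho, ← h]
  refine sum_congr rfl fun i _ => ?_
  rw [pow_zero, div_one, lagr, Lagrange.basis, eval_prod]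
  refine prod_congr rfl fun j _ => ?_
  simp [Lagrange.basisDivisor, div_eq_mul_inv, mul_comm]

/-- The power series with coefficients `a_k` and `ρ_k` are inverse to each other. -/
theorem sum_coeffA_mul_rho (hinj : Function.Injective xs) (k : ℕ) :
    ∑ s ∈ range (k + 1), coeffA xs x s * rho xs x (k - s) = if k = 0 then 1 else 0 := by
  cases k with
  | zero => simp [rho_zero hinj, coeffA]
  | succ k =>
    rw [sum_range_succ, Nat.sub_self, rho_zero hinj, mul_one, coeffA, if_neg (by omega),
      Fin.sum_univ_eq_sum_range (fun s => rho xs x (k + 1 - s) * coeffA xs x s)]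
    simp only [mul_comm, add_neg_cancel]

theorem sum_coeffA_mul_sum_rho (hinj : Function.Injective xs) (g : ℕ → ℝ) (t : ℕ) :
    ∑ s ∈ range (t + 1), coeffA xs x s * ∑ k ∈ range (t - s + 1), g k * rho xs x (t - s - k)
      = g t := by
  have hswap : ∑ s ∈ range (t + 1), coeffA xs x s *
        ∑ k ∈ range (t - s + 1), g k * rho xs x (t - s - k)
      = ∑ k ∈ range (t + 1), g k *
        ∑ s ∈ range (t - k + 1), coeffA xs x s * rho xs x (t - k - s) := by
    simp only [mul_sum]
    rw [sum_comm' (t' := range (t + 1)) (s' := fun k => range (t - k + 1))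
      (by intro s k; simp only [mem_range]; omega)]
    refine sum_congr rfl fun k _ => sum_congr rfl fun s _ => ?_
    rw [Nat.sub_right_comm]
    ring
  rw [hswap, sum_range_succ, sum_eq_zero]
  · rw [sum_coeffA_mul_rho hinj]
    simp
  · intro k hk
    rw [sum_coeffA_mul_rho hinj, if_neg (by have := mem_range.1 hk; omega), mul_zero]

/-- The factor `x - x_i` from `prod_sub_mul_nodalWeight` cancels one power in the denominator `(x_i
- x) ^ (m + 1)` and flips the sign. -/
theorem prod_mul_divDiff (f : ℝ → ℝ) (S : Set ℝ) (hinj : Function.Injective xs)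
    (hne : ∀ i, xs i ≠ x) (m : ℕ) :
    (∏ i, (x - xs i)) * divDiff f S (List.replicate (m + 1) x ++ List.ofFn xs)
      = ∑ k ∈ range (m + 1),
          iteratedDerivWithin k f S x / (Nat.factorial k : ℝ) * rho xs x (m - k)
        - ∑ i, f (xs i) * lagr xs x i / (xs i - x) ^ m := by
  rw [divDiff_replicate_append_ofFn f S hinj hne]
  set g : ℕ → ℝ := fun k => iteratedDerivWithin k f S x / (Nat.factorial k : ℝ)
  simp only [rho, mul_sum]
  rw [sum_comm, ← sum_sub_distrib]
  refine sum_congr rfl fun i _ => ?_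
  have hi : xs i - x ≠ 0 := sub_ne_zero.2 (hne i)
  have hpow : ∑ k ∈ range (m + 1), g k * (lagr xs x i / (xs i - x) ^ (m - k))
      = (∑ k ∈ range (m + 1), g k * (xs i - x) ^ k) * lagr xs x i / (xs i - x) ^ m := by
    rw [sum_mul, sum_div]
    refine sum_congr rfl fun k hk => ?_
    rw [pow_sub₀ _ hi (by have := mem_range.1 hk; omega)]
    field_simp
  rw [hpow, mul_left_comm, prod_sub_mul_nodalWeight, taylorQuotient]
  field_simp
  ring

/-- The derivative of order `t` in terms of divided differences, with all differences up to the
one with a single argument `x`. -/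
theorem iteratedDerivWithin_div_factorial_eq (f : ℝ → ℝ) (S : Set ℝ)
    (hinj : Function.Injective xs) (hne : ∀ i, xs i ≠ x) (t : ℕ) :
    iteratedDerivWithin t f S x / (Nat.factorial t : ℝ)
      = (∑ i, (∑ s ∈ range (t + 1), coeffA xs x s / (xs i - x) ^ (t - s))
            * f (xs i) * lagr xs x i)
        + (∏ i, (x - xs i)) * ∑ s ∈ range (t + 1), coeffA xs x s *
            divDiff f S (List.replicate (t - s + 1) x ++ List.ofFn xs) := by
  have h1 : (∏ i, (x - xs i)) * ∑ s ∈ range (t + 1), coeffA xs x s *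
        divDiff f S (List.replicate (t - s + 1) x ++ List.ofFn xs)
      = iteratedDerivWithin t f S x / (Nat.factorial t : ℝ)
        - ∑ s ∈ range (t + 1), ∑ i, coeffA xs x s *
          (f (xs i) * lagr xs x i / (xs i - x) ^ (t - s)) := by
    rw [← sum_coeffA_mul_sum_rho (x := x) hinj
      (fun k => iteratedDerivWithin k f S x / (Nat.factorial k : ℝ)) t, ← sum_sub_distrib, mul_sum]
    refine sum_congr rfl fun s _ => ?_
    rw [mul_left_comm, prod_mul_divDiff f S hinj hne, mul_sub, ← mul_sum]
  rw [h1, sum_comm]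
  have h2 : ∀ i, (∑ s ∈ range (t + 1), coeffA xs x s / (xs i - x) ^ (t - s))
        * f (xs i) * lagr xs x i
      = ∑ s ∈ range (t + 1), coeffA xs x s *
          (f (xs i) * lagr xs x i / (xs i - x) ^ (t - s)) := by
    intro i
    rw [mul_assoc, sum_mul]
    exact sum_congr rfl fun s _ => by ring
  simp only [h2]
  ring

/-- Trading the last terms for `a_t f(x)`: the Lagrange interpolation formula with remainder. -/
theorem sum_lagr_add_prod_mul_sum (f : ℝ → ℝ) (S : Set ℝ) (hinj : Function.Injective xs)
    (hne : ∀ i, xs i ≠ x) (t : ℕ) (d : ℕ → ℝ)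
    (hd : d t = divDiff f S (List.replicate 1 x ++ List.ofFn xs)) :
    (∑ i, (∑ s ∈ range (t + 1), coeffA xs x s / (xs i - x) ^ (t - s)) * f (xs i) * lagr xs x i)
        + (∏ i, (x - xs i)) * ∑ s ∈ range (t + 1), coeffA xs x s * d s
      = (∑ i, (∑ s ∈ range t, coeffA xs x s / (xs i - x) ^ (t - s)) * f (xs i) * lagr xs x i)
        + coeffA xs x t * f x
        + (∏ i, (x - xs i)) * ∑ s ∈ range t, coeffA xs x s * d s := by
  have h := prod_mul_divDiff f S hinj hne 0
  rw [zero_add, ← hd] at h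
  simp only [range_one, sum_singleton, Nat.sub_zero, rho_zero hinj, pow_zero, div_one,
    iteratedDerivWithin_zero, Nat.factorial_zero, Nat.cast_one, mul_one] at h
  have h2 : ∑ i, (∑ s ∈ range (t + 1), coeffA xs x s / (xs i - x) ^ (t - s))
        * f (xs i) * lagr xs x i
      = ∑ i, (∑ s ∈ range t, coeffA xs x s / (xs i - x) ^ (t - s)) * f (xs i) * lagr xs x i
        + coeffA xs x t * ∑ i, f (xs i) * lagr xs x i := by
    rw [mul_sum, ← sum_add_distrib]
    refine sum_congr rfl fun i _ => ?_
    rw [sum_range_succ, Nat.sub_self, pow_zero]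
    ring
  rw [h2, sum_range_succ]
  linear_combination coeffA xs x t * h

end Coefficients

end NumDiff

/-! ### The main theorem -/

theorem theorem5p1 (n t : ℕ) (p q x : ℝ) (xs : Fin (n + 1) → ℝ) (f : ℝ → ℝ)
    (hx : x ∈ Set.Icc p q) (hxs : ∀ i, xs i ∈ Set.Icc p q)
    (hinj : Function.Injective xs) (hne : ∀ i, xs i ≠ x)
    (hf : ContDiffOn ℝ ((n + t + 1 : ℕ) : WithTop ℕ∞) f (Set.Icc p q)) :
    (iteratedDerivWithin t f (Set.Icc p q) x / (Nat.factorial t : ℝ)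
      = (∑ i, (∑ s ∈ Finset.range t, NumDiff.coeffA xs x s / (xs i - x) ^ (t - s))
            * f (xs i) * NumDiff.lagr xs x i)
        + NumDiff.coeffA xs x t * f x
        + (∏ i, (x - xs i)) * ∑ s ∈ Finset.range t, NumDiff.coeffA xs x s *
            NumDiff.divDiff f (Set.Icc p q) (List.replicate (t - s + 1) x ++ List.ofFn xs))
    ∧ ∃ ξ : ℕ → ℝ,
      (∀ s ≤ t, ξ s ∈ convexHull ℝ (insert x (Set.range xs)))
      ∧ (iteratedDerivWithin t f (Set.Icc p q) x / (Nat.factorial t : ℝ)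
        = (∑ i, (∑ s ∈ Finset.range t, NumDiff.coeffA xs x s / (xs i - x) ^ (t - s))
              * f (xs i) * NumDiff.lagr xs x i)
          + NumDiff.coeffA xs x t * f x
          + (∏ i, (x - xs i)) * ∑ s ∈ Finset.range t, NumDiff.coeffA xs x s *
              (iteratedDerivWithin (t + n + 1 - s) f (Set.Icc p q) (ξ s)
                / (Nat.factorial (t + n + 1 - s) : ℝ)))
      ∧ (iteratedDerivWithin t f (Set.Icc p q) x / (Nat.factorial t : ℝ)
        = (∑ i, (∑ s ∈ Finset.range (t + 1), NumDiff.coeffA xs x s / (xs i - x) ^ (t - s))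
              * f (xs i) * NumDiff.lagr xs x i)
          + (∏ i, (x - xs i)) * ∑ s ∈ Finset.range (t + 1), NumDiff.coeffA xs x s *
              (iteratedDerivWithin (t + n + 1 - s) f (Set.Icc p q) (ξ s)
                / (Nat.factorial (t + n + 1 - s) : ℝ))) := by
  have hd : ∀ s ∈ Finset.range (t + 1), ∃ ξ ∈ convexHull ℝ (insert x (Set.range xs)),
      NumDiff.divDiff f (Set.Icc p q) (List.replicate (t - s + 1) x ++ List.ofFn xs)
        = iteratedDerivWithin (t + n + 1 - s) f (Set.Icc p q) ξ
          / (Nat.factorial (t + n + 1 - s) : ℝ) := by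
    intro s hs
    have hst := Finset.mem_range.1 hs
    rw [show t + n + 1 - s = n + (t - s + 1) by omega]
    exact NumDiff.exists_divDiff_eq_iteratedDerivWithin hx hxs hinj hne
      (hf.of_le (by exact_mod_cast (by omega : n + (t - s + 1) ≤ n + t + 1)))
  -- Each `ξ s` depends only on its divided difference, so one choice serves both mean value forms.
  choose! ξ hξK hξ using hd
  have hfull := NumDiff.iteratedDerivWithin_div_factorial_eq f (Set.Icc p q) hinj hne t
  have hshort := hfull.trans (NumDiff.sum_lagr_add_prod_mul_sum f (Set.Icc p q) hinj hne t
    (fun s => NumDiff.divDiff f (Set.Icc p q) (List.replicate (t - s + 1) x ++ List.ofFn xs))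
    (by simp only [Nat.sub_self, zero_add]))
  refine ⟨hshort, ξ, fun s hs => hξK s (Finset.mem_range.2 (by omega)), ?_, ?_⟩
  · rw [hshort]
    congr 2
    refine Finset.sum_congr rfl fun s hs => ?_
    rw [hξ s (Finset.mem_range.2 (by have := Finset.mem_range.1 hs; omega))]
  · rw [hfull]
    congr 2
    refine Finset.sum_congr rfl fun s hs => ?_
    rw [hξ s hs]
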